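/- Let $H$ be a real, complex or quaternionic Hilbert space of any dimension. Bounded Hermitian operators on $H$ are ordered by $A\le B$ iff $((B-A)\omega,\omega)\ge 0$ for all $\omega\in H$. Let $\mathcal E(H)$ be the set of Hermitian operators $A$ with $0\le A\le I$, let $\mathcal P(H)$ be the set of orthogonal projectors of $H$, and let $E$ be either $\mathcal E(H)$ or $\mathcal P(H)$. Suprema $\bigvee$ and infima $\bigwedge$ are taken in the poset $E$. Let $n\ge 1$ be an integer. An $n$-dimensional spectral resolution on $E$ is a mapping $F:\mathbb R^n\to E$ such that 1. $F(s_1,\ldots,s_n)\le F(t_1,\ldots,t_n)$ whenever $s_i\le t_i$ for all $i$; 2. $\bigvee_{(s_1,\ldots,s_n)\in\mathbb R^n}F(s_1,\ldots,s_n)=I$; 3. $\bigvee\{F(s_1,\ldots,s_n): s_i<t_i \text{ for all } i\}=F(t_1,\ldots,t_n)$ for all $(t_1,\ldots,t_n)\in\mathbb R^n$; 4. $\bigwedge_{t\in\mathbb R}F(s_1,\ldots,s_{i-1},t,s_{i+1},\ldots,s_n)=0$ for every $i$ and all $s_j\in\mathbb R$ ($j\neq i$); 5. $\Delta_1(a_1,b_1)\cdots\Delta_n(a_n,b_n)F\ge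 0$ for all reals $a_i\le b_i$, $i=1,\ldots,n$, where $\Delta_i(a,b)K(s_1,\ldots,s_n)=K(s_1,\ldots,s_{i-1},b,s_{i+1},\ldots,s_n)-K(s_1,\ldots,s_{i-1},a,s_{i+1},\ldots,s_n)$. An $n$-dimensional observable on $E$ is a mapping $x:\mathcal B(\mathbb R^n)\to E$ on the Borel $\sigma$-algebra of $\mathbb R^n$ such that $x(\mathbb R^n)=I$; $x(A\cup B)=x(A)+x(B)$ whenever $A\cap B=\emptyset$; and $\bigvee_k x(A_k)=x(A)$ whenever $A_1\subseteq A_2\subseteq\cdots$ are Borel sets with union $A$. Theorem. For every $n$-dimensional spectral resolution $F$ on $\mathcal E(H)$ (respectively, on $\mathcal P(H)$) there is a unique $n$-dimensional observable $x$ on $\mathcal E(H)$ (respectively, on $\mathcal P(H)$) such that $$F(s_1,\ldots,s_n)=x\big((-\infty,s_1)\times\cdots\times(-\infty,s_n)\big)\quad\text{for all } s_1,\ldots,s_n\in\mathbb R.$$ -/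

import Mathlib

open scoped Quaternion

/-! ### Spectral resolutions and observables with values in a part of a po-group

Below, `G` is a partially ordered Abelian group with a distinguished element `1`, and `E` is a
subset of `G` with least element `0` and greatest element `1`, regarded as an effect algebra:
`a + b` is defined in `E` if and only if the sum of `a` and `b` in `G` belongs to `E`. -/

/-- `a` is the supremum of `S` in the poset `E` (with the order inherited from `G`). -/
def IsSupIn {G : Type*} [PartialOrder G] (E S : Set G) (a : G) : Prop :=
  IsLeast (E ∩ upperBounds S) a

/-- `a` is the infimum of `S` in the poset `E` (with the order inherited from `G`). -/
def IsInfIn {G : Type*} [PartialOrder G] (E S : Set G) (a : G) : Prop :=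
  IsGreatest (E ∩ lowerBounds S) a

/-- The difference operator `Δ_i(a, b)`:
`Δ_i(a, b) K (s) = K (s₁, …, b, …, sₙ) - K (s₁, …, a, …, sₙ)`, with `b`, `a` at the place `i`. -/
def coordDiff {G : Type*} [AddCommGroup G] {n : ℕ} (i : Fin n) (a b : ℝ)
    (K : (Fin n → ℝ) → G) : (Fin n → ℝ) → G :=
  fun s => K (Function.update s i b) - K (Function.update s i a)

/-- The iterated difference `Δ_1(a₁, b₁) (Δ_2(a₂, b₂) (⋯ (Δ_n(aₙ, bₙ) K)))`. -/
def iterDiff {G : Type*} [AddCommGroup G] {n : ℕ} (a b : Fin n → ℝ)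
    (K : (Fin n → ℝ) → G) : (Fin n → ℝ) → G :=
  (List.finRange n).foldr (fun i L => coordDiff i (a i) (b i) L) K

/-- An `n`-dimensional spectral resolution on `E`. -/
structure SpectralResolution {G : Type*} [AddCommGroup G] [One G] [PartialOrder G]
    (E : Set G) (n : ℕ) where
  toFun : (Fin n → ℝ) → G
  mem : ∀ s, toFun s ∈ E
  mono : ∀ s t, (∀ i, s i ≤ t i) → toFun s ≤ toFun t
  sup_eq_one : IsSupIn E (Set.range toFun) 1
  left_cont : ∀ t, IsSupIn E {g | ∃ s : Fin n → ℝ, (∀ i, s i < t i) ∧ toFun s = g} (toFun t)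
  inf_eq_zero : ∀ (i : Fin n) (s : Fin n → ℝ),
    IsInfIn E (Set.range fun t : ℝ => toFun (Function.update s i t)) 0
  volume : ∀ a b : Fin n → ℝ, (∀ i, a i ≤ b i) → ∀ s, 0 ≤ iterDiff a b toFun s

/-- An `n`-dimensional observable on `E`: a map from the Borel `σ`-algebra of `ℝⁿ` to `E`. -/
structure Observable {G : Type*} [AddCommGroup G] [One G] [PartialOrder G]
    (E : Set G) (n : ℕ) where
  toFun : {A : Set (Fin n → ℝ) // MeasurableSet A} → G
  mem : ∀ A, toFun A ∈ E
  map_univ : toFun ⟨Set.univ, MeasurableSet.univ⟩ = 1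
  map_union : ∀ (A B : Set (Fin n → ℝ)) (hA : MeasurableSet A) (hB : MeasurableSet B),
    A ∩ B = ∅ → toFun ⟨A ∪ B, hA.union hB⟩ = toFun ⟨A, hA⟩ + toFun ⟨B, hB⟩
  map_iUnion : ∀ (A : ℕ → Set (Fin n → ℝ)) (hA : ∀ k, MeasurableSet (A k)), Monotone A →
    IsSupIn E (Set.range fun k => toFun ⟨A k, hA k⟩)
      (toFun ⟨⋃ k, A k, MeasurableSet.iUnion hA⟩)

/-- The Borel set `(-∞, s₁) × ⋯ × (-∞, sₙ)`. -/
def lowerOrthant {n : ℕ} (s : Fin n → ℝ) : {A : Set (Fin n → ℝ) // MeasurableSet A} :=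
  ⟨Set.univ.pi fun i => Set.Iio (s i),
    MeasurableSet.univ_pi fun _ => measurableSet_Iio⟩

/-! ### Real and complex Hilbert spaces -/

/-- `𝓔(H)`: the Hermitian operators `A` with `0 ≤ A ≤ I` (in the Loewner order, where `A ≤ B`
means that `B - A` is a positive Hermitian operator). -/
def effects (𝕜 H : Type*) [RCLike 𝕜] [NormedAddCommGroup H] [InnerProductSpace 𝕜 H] :
    Set (H →L[𝕜] H) :=
  Set.Icc 0 1

/-- `𝓟(H)`: the orthogonal projectors of `H`. -/
def projectors (𝕜 H : Type*) [RCLike 𝕜] [NormedAddCommGroup H] [InnerProductSpace 𝕜 H]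
    [CompleteSpace H] : Set (H →L[𝕜] H) :=
  {P | IsStarProjection P}

/-! ### Quaternionic Hilbert spaces -/

/-- A (left) quaternionic inner product space: a left `ℍ`-module with an `ℍ`-valued Hermitian
form, `ℍ`-linear in the first variable, which induces the given norm. It is a quaternionic Hilbert
space if it is complete. -/
class QuaternionicInnerProductSpace (H : Type*) [NormedAddCommGroup H] extends
    Module ℍ H, Inner ℍ H where
  norm_sq_eq_re_inner : ∀ x : H, ‖x‖ ^ 2 = (inner x x).re
  conj_inner_symm : ∀ x y : H, star (inner y x) = inner x y
  add_left : ∀ x y z : H, inner (x + y) z = inner x z + inner y z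
  smul_left : ∀ (x y : H) (q : ℍ), inner (q • x) y = q * inner x y

namespace QuaternionicInnerProductSpace

variable {H : Type*} [NormedAddCommGroup H] [QuaternionicInnerProductSpace H]

/-- The operator `A` is Hermitian. -/
def IsHermitian (A : H →L[ℍ] H) : Prop :=
  ∀ x y : H, inner ℍ (A x) y = inner ℍ x (A y)

/-- The operator `A` is Hermitian and `⟪A x, x⟫ ≥ 0` for all `x`; this inner product is a real
number by hermiticity. -/
def IsPositive (A : H →L[ℍ] H) : Prop :=
  IsHermitian A ∧ ∀ x : H, 0 ≤ (inner ℍ (A x) x).re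

theorem inner_add_right (x y z : H) : inner ℍ x (y + z) = inner ℍ x y + inner ℍ x z := by
  rw [← conj_inner_symm, add_left, star_add, conj_inner_symm, conj_inner_symm]

theorem inner_neg_left (x y : H) : inner ℍ (-x) y = -inner ℍ x y := by
  rw [← neg_one_smul ℍ x, smul_left, neg_one_mul]

theorem inner_neg_right (x y : H) : inner ℍ x (-y) = -inner ℍ x y := by
  rw [← conj_inner_symm, inner_neg_left, star_neg, conj_inner_symm]

theorem inner_zero_left (y : H) : inner ℍ (0 : H) y = 0 := by
  rw [← zero_smul ℍ (0 : H), smul_left, zero_mul]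

theorem inner_zero_right (x : H) : inner ℍ x (0 : H) = 0 := by
  rw [← conj_inner_symm, inner_zero_left, star_zero]

theorem IsPositive.add {A B : H →L[ℍ] H} (hA : IsPositive A) (hB : IsPositive B) :
    IsPositive (A + B) := by
  refine ⟨fun x y => ?_, fun x => ?_⟩
  · rw [add_apply, add_apply, add_left, inner_add_right,
      hA.1, hB.1]
  · rw [add_apply, add_left, Quaternion.re_add]
    exact add_nonneg (hA.2 x) (hB.2 x)

theorem IsPositive.eq_zero {A : H →L[ℍ] H} (hA : IsPositive A) (hA' : IsPositive (-A)) :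
    A = 0 := by
  have h0 : ∀ x : H, (inner ℍ (A x) x).re = 0 := fun x => by
    have h := hA'.2 x
    rw [neg_apply, inner_neg_left, Quaternion.re_neg] at h
    linarith [hA.2 x]
  ext x
  have h := h0 (x + A x)
  have h1 : inner ℍ (A (A x)) x = inner ℍ (A x) (A x) := hA.1 _ _
  rw [map_add, add_left, inner_add_right, inner_add_right, h1] at h
  simp only [Quaternion.re_add, h0, ← norm_sq_eq_re_inner] at h
  have h2 : ‖A x‖ = 0 := by nlinarith [norm_nonneg (A x)]
  simpa using h2

/-- The order on operators: `A ≤ B` if and only if `B - A` is a positive Hermitian operator. -/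
instance : PartialOrder (H →L[ℍ] H) where
  le A B := IsPositive (B - A)
  le_refl A := by
    refine ⟨fun x y => ?_, fun x => ?_⟩
    · simp [inner_zero_left, inner_zero_right]
    · simp [inner_zero_left]
  le_trans A B C hAB hBC := by
    have h := IsPositive.add hBC hAB
    rwa [sub_add_sub_cancel] at h
  le_antisymm A B hAB hBA := by
    rw [← neg_sub] at hBA
    exact (sub_eq_zero.mp (IsPositive.eq_zero hAB hBA)).symm

/-- `𝓔(H)` for a quaternionic `H`: the Hermitian operators `A` with `0 ≤ A ≤ I`. -/
def effects (H : Type*) [NormedAddCommGroup H] [QuaternionicInnerProductSpace H] :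
    Set (H →L[ℍ] H) :=
  Set.Icc 0 1

/-- `𝓟(H)` for a quaternionic `H`: the orthogonal projectors, i.e. the Hermitian idempotents. -/
def projectors (H : Type*) [NormedAddCommGroup H] [QuaternionicInnerProductSpace H] :
    Set (H →L[ℍ] H) :=
  {P | P * P = P ∧ IsHermitian P}

end QuaternionicInnerProductSpace

/-! The order of `E` is read off from the real quadratic forms `q v T = ⟪T v, v⟫`, so the problem
becomes scalar. For each `v`, the function `s ↦ q v (F s)` is an `n`-dimensional distribution
function and hence comes from a finite measure `μ v` (`IsDistribution.exists_measure`). It remains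
to find, for each Borel `A`, one element of `E` with quadratic form `v ↦ μ v A`.

The measure: indicators of orthants are linearly independent, so a distribution function `f` defines
a linear functional `L` on step functions. The volume condition says `L ≥ 0` on boxes; refining to
grids and exhausting by large boxes gives `L ≥ 0` on all nonnegative step functions. M. Riesz
extension carries positivity over to `C_c`, and Riesz–Markov–Kakutani yields a measure. Inner
regularity and left continuity identify it on orthants.

Back to operators: the sets `A` whose values `μ v A` are represented in `E` contain the orthants, a
π-system, and form a Dynkin class. This rests on closure of `E` under complements, sums bounded by
`1`, and monotone limits, recorded in `IsMonotoneDetermined`. The same induction gives uniqueness.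

These closure properties hold for effects and projectors because a bounded monotone sequence of
effects converges strongly. Real, complex and quaternionic spaces are treated together: they carry
the real inner product `Re ⟪x, y⟫`, and an operator linear over the scalars is Hermitian exactly
when it is symmetric for that product. -/

open Filter Topology MeasureTheory

/-! ### Indicators of orthants and boxes; prescribing a functional on them. -/

/-- The indicator function of `(-∞, t)`. -/
noncomputable def rayInd (t u : ℝ) : ℝ := if u < t then 1 else 0

/-- The indicator function of the orthant with corner `s`. -/
noncomputable def orthantInd {n : ℕ} (s x : Fin n → ℝ) : ℝ := ∏ i, rayInd (s i) (x i)

/-- The indicator function of the half-open box `[a, b)`. -/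
noncomputable def boxInd {n : ℕ} (a b x : Fin n → ℝ) : ℝ :=
  ∏ i, (rayInd (b i) (x i) - rayInd (a i) (x i))

theorem rayInd_mul (s t u : ℝ) : rayInd s u * rayInd t u = rayInd (min s t) u := by
  unfold rayInd; split_ifs <;> simp_all <;> grind

theorem orthantInd_eq_ite {n : ℕ} (s x : Fin n → ℝ) :
    orthantInd s x = if ∀ i, x i < s i then 1 else 0 := by
  split_ifs with h
  · exact Finset.prod_eq_one fun i _ => by simp [rayInd, h i]
  · push Not at h
    obtain ⟨i, hi⟩ := h
    exact Finset.prod_eq_zero (Finset.mem_univ i) (by simp [rayInd, hi])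

theorem boxInd_eq_ite {n : ℕ} {a b : Fin n → ℝ} (hab : ∀ i, a i ≤ b i) (x : Fin n → ℝ) :
    boxInd a b x = if ∀ i, a i ≤ x i ∧ x i < b i then 1 else 0 := by
  split_ifs with h
  · exact Finset.prod_eq_one fun i _ => by simp [rayInd, (h i).2, (h i).1]
  · push Not at h
    obtain ⟨i, hi⟩ := h
    refine Finset.prod_eq_zero (Finset.mem_univ i) ?_
    have := hab i
    unfold rayInd
    grind

/-- Let `s` be maximal in the support of a vanishing combination. Just below the corner `s`, at `s -
ε` in every coordinate, the only orthants of the support that are present have corners `t ≥ s`,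
hence only `s` itself, so its coefficient is zero. -/
theorem linearIndependent_orthantInd (n : ℕ) :
    LinearIndependent ℝ (orthantInd : (Fin n → ℝ) → (Fin n → ℝ) → ℝ) := by
  rw [linearIndependent_iff]
  intro c hc
  by_contra hne
  obtain ⟨s, hs⟩ := Finset.exists_maximal (Finsupp.support_nonempty_iff.mpr hne)
  have hε : ∀ᶠ ε : ℝ in 𝓝[>] 0, ∀ t ∈ c.support, (∀ i, s i - ε < t i) → s ≤ t := by
    rw [Finset.eventually_all]
    intro t _
    by_cases hst : s ≤ t
    · exact Eventually.of_forall fun _ _ => hst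
    · rw [Pi.le_def] at hst
      push Not at hst
      obtain ⟨i, hi⟩ := hst
      have : ∀ᶠ ε : ℝ in 𝓝[>] 0, ε < s i - t i :=
        nhdsWithin_le_nhds (Iio_mem_nhds (by linarith))
      filter_upwards [this] with ε h1 h2
      linarith [h2 i]
  obtain ⟨ε, h1, h2⟩ := (hε.and self_mem_nhdsWithin).exists
  have h3 := congrFun hc (fun i => s i - ε)
  rw [Finsupp.linearCombination_apply, Finsupp.sum, Finset.sum_apply,
    Finset.sum_eq_single s] at h3
  · have h4 : ∀ i, s i - ε < s i := fun i => by
      have : (0 : ℝ) < ε := h2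
      linarith
    simp only [Pi.smul_apply, orthantInd_eq_ite, h4, implies_true, if_true, smul_eq_mul, mul_one,
      Pi.zero_apply] at h3
    exact Finsupp.mem_support_iff.mp hs.prop h3
  · intro t ht hts
    rw [Pi.smul_apply, orthantInd_eq_ite, if_neg, smul_zero]
    intro h
    exact hts (le_antisymm (hs.le_of_ge ht (h1 t ht h)) (h1 t ht h))
  · exact fun h => absurd hs.prop h

/-- The extension beyond the span of the orthant indicators is arbitrary; it only spares carrying
the subspace around. -/
theorem exists_linearMap_orthantInd {n : ℕ} (f : (Fin n → ℝ) → ℝ) :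
    ∃ L : ((Fin n → ℝ) → ℝ) →ₗ[ℝ] ℝ, ∀ s, L (orthantInd s) = f s := by
  have hli := linearIndependent_orthantInd n
  obtain ⟨L, hL⟩ := LinearMap.exists_extend ((Module.Basis.span hli).constr ℝ f)
  refine ⟨L, fun s => ?_⟩
  have := LinearMap.congr_fun hL (Module.Basis.span hli s)
  rw [Module.Basis.constr_basis] at this
  rw [← this]
  simp [Module.Basis.span_apply]

/-! ### Iterated differences as values on box indicators. -/

theorem map_foldr_coordDiff {G G' : Type*} [AddCommGroup G] [AddCommGroup G'] {n : ℕ}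
    (φ : G →+ G') (a b : Fin n → ℝ) (K : (Fin n → ℝ) → G) (l : List (Fin n)) (s : Fin n → ℝ) :
    φ (l.foldr (fun i L => coordDiff i (a i) (b i) L) K s) =
      l.foldr (fun i L => coordDiff i (a i) (b i) L) (fun s => φ (K s)) s := by
  induction l generalizing s with
  | nil => rfl
  | cons i l ih => simp only [List.foldr_cons, coordDiff, map_sub, ih]

theorem map_iterDiff {G G' : Type*} [AddCommGroup G] [AddCommGroup G'] {n : ℕ}
    (φ : G →+ G') (a b : Fin n → ℝ) (K : (Fin n → ℝ) → G) (s : Fin n → ℝ) :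
    φ (iterDiff a b K s) = iterDiff a b (fun s => φ (K s)) s :=
  map_foldr_coordDiff φ a b K _ s

/-- The orthant indicator is a product over coordinates, so each difference operator alters only its
own factor. Partial lists make the induction possible. -/
theorem foldr_coordDiff_orthantInd {n : ℕ} (a b x : Fin n → ℝ) (l : List (Fin n)) (hl : l.Nodup)
    (s : Fin n → ℝ) :
    l.foldr (fun i L => coordDiff i (a i) (b i) L) (fun s => orthantInd s x) s =
      ∏ i, if i ∈ l then rayInd (b i) (x i) - rayInd (a i) (x i) else rayInd (s i) (x i) := by
  induction l generalizing s with
  | nil => simp [orthantInd]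
  | cons i l ih =>
    rw [List.nodup_cons] at hl
    simp only [List.foldr_cons, coordDiff, ih hl.2]
    rw [← Finset.mul_prod_erase _ _ (Finset.mem_univ i), ← Finset.mul_prod_erase _ _
      (Finset.mem_univ i), ← Finset.mul_prod_erase _ _ (Finset.mem_univ i)]
    have h : ∀ c : ℝ, ∏ j ∈ Finset.univ.erase i,
        (if j ∈ l then rayInd (b j) (x j) - rayInd (a j) (x j)
          else rayInd (Function.update s i c j) (x j)) = ∏ j ∈ Finset.univ.erase i,
        if j ∈ i :: l then rayInd (b j) (x j) - rayInd (a j) (x j) else rayInd (s j) (x j) := by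
      intro c
      refine Finset.prod_congr rfl fun j hj => ?_
      have hji := Finset.ne_of_mem_erase hj
      simp [hji]
    rw [h, h]
    simp [hl.1, sub_mul]

theorem iterDiff_orthantInd {n : ℕ} (a b s x : Fin n → ℝ) :
    iterDiff a b (fun s => orthantInd s x) s = boxInd a b x := by
  unfold iterDiff
  rw [foldr_coordDiff_orthantInd a b x _ (List.nodup_finRange n)]
  simp [boxInd]

theorem iterDiff_orthantInd' {n : ℕ} (a b s : Fin n → ℝ) :
    iterDiff a b orthantInd s = boxInd a b := by
  ext x
  rw [← iterDiff_orthantInd a b s x]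
  exact map_iterDiff (Pi.evalAddMonoidHom (fun _ : Fin n → ℝ => ℝ) x) a b orthantInd s

theorem map_boxInd {n : ℕ} (L : ((Fin n → ℝ) → ℝ) →ₗ[ℝ] ℝ) (a b s : Fin n → ℝ) :
    L (boxInd a b) = iterDiff a b (fun s => L (orthantInd s)) s := by
  rw [← iterDiff_orthantInd' a b s]
  exact map_iterDiff L.toAddMonoidHom a b orthantInd s

/-! ### Grids, and positivity on step functions cut to a box. -/

theorem exists_partition {a b : ℝ} (hab : a ≤ b) (T : Finset ℝ) :
    ∃ (m : ℕ) (t : ℕ → ℝ), Monotone t ∧ t 0 = a ∧ t m = b ∧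
      ∀ x ∈ T, ∀ j < m, ¬ (t j < x ∧ x < t (j + 1)) := by
  set S : Finset ℝ := insert a (insert b (T.filter fun x => a < x ∧ x < b)) with hS
  have hmem : ∀ x ∈ S, a ≤ x ∧ x ≤ b := by
    intro x hx
    simp only [hS, Finset.mem_insert, Finset.mem_filter] at hx
    grind
  have haS : a ∈ S := by simp [hS]
  have hbS : b ∈ S := by simp [hS]
  have hpos : 0 < S.card := Finset.card_pos.mpr ⟨a, haS⟩
  set e := S.orderEmbOfFin rfl with he
  have heS : ∀ i, e i ∈ S := fun i => S.orderEmbOfFin_mem rfl i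
  have hsurj : ∀ x ∈ S, ∃ i, e i = x := fun x hx => by
    have := S.range_orderEmbOfFin rfl
    exact (this ▸ hx : x ∈ Set.range e)
  have hlt : ∀ j, min j (S.card - 1) < S.card := fun j => by omega
  have hmono : Monotone fun j : ℕ => e ⟨min j (S.card - 1), hlt j⟩ := fun i j hij =>
    e.monotone (by rw [Fin.mk_le_mk]; omega)
  -- The partition lists the endpoints and the points of `T` strictly between them in increasing
  -- order. Clamping the index at the last point makes it a monotone sequence on all of `ℕ`; if `a =
  -- b` there are no cells.
  refine ⟨S.card - 1, fun j => e ⟨min j (S.card - 1), hlt j⟩, hmono, ?_, ?_, ?_⟩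
  · obtain ⟨i, hi⟩ := hsurj a haS
    refine le_antisymm ?_ (hmem _ (heS _)).1
    rw [← hi]
    exact e.monotone (by rw [Fin.le_def]; simp)
  · obtain ⟨i, hi⟩ := hsurj b hbS
    refine le_antisymm (hmem _ (heS _)).2 ?_
    rw [← hi]
    exact e.monotone (by rw [Fin.le_def]; simp; omega)
  · rintro x hx j hj ⟨h1, h2⟩
    have hxS : x ∈ S := by
      simp only [hS, Finset.mem_insert, Finset.mem_filter]
      exact Or.inr (Or.inr ⟨hx, (hmem _ (heS _)).1.trans_lt h1, h2.trans_le (hmem _ (heS _)).2⟩)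
    obtain ⟨i, rfl⟩ := hsurj x hxS
    rw [e.lt_iff_lt, Fin.lt_def] at h1 h2
    simp only at h1 h2
    omega

theorem boxInd_const_eq_sum {n : ℕ} {a b : ℝ} {m : ℕ} {t : ℕ → ℝ} (h0 : t 0 = a) (hm : t m = b)
    (x : Fin n → ℝ) :
    boxInd (fun _ => a) (fun _ => b) x =
      ∑ p ∈ Fintype.piFinset fun _ : Fin n => Finset.range m,
        boxInd (fun i => t (p i)) (fun i => t (p i + 1)) x := by
  have h : ∀ i : Fin n, rayInd b (x i) - rayInd a (x i) =
      ∑ j ∈ Finset.range m, (rayInd (t (j + 1)) (x i) - rayInd (t j) (x i)) := fun i => by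
    rw [Finset.sum_range_sub (fun j => rayInd (t j) (x i)), h0, hm]
  simp only [boxInd, h]
  exact Finset.prod_univ_sum _ _

/-- The step functions: linear combinations of indicator functions of orthants. -/
abbrev stepSpan (n : ℕ) : Submodule ℝ ((Fin n → ℝ) → ℝ) :=
  Submodule.span ℝ (Set.range orthantInd)

/-- Only finitely many corners enter `g`, and their coordinates serve as the thresholds. -/
theorem exists_finset_of_mem_stepSpan {n : ℕ} {g : (Fin n → ℝ) → ℝ} (hg : g ∈ stepSpan n) :
    ∃ T : Finset ℝ, ∀ x y : Fin n → ℝ, (∀ i, ∀ t ∈ T, x i < t ↔ y i < t) → g x = g y := by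
  classical
  induction hg using Submodule.span_induction with
  | mem g hg =>
    obtain ⟨s, rfl⟩ := hg
    refine ⟨Finset.univ.image s, fun x y h => ?_⟩
    rw [orthantInd_eq_ite, orthantInd_eq_ite]
    simp only [fun i => h i (s i) (Finset.mem_image_of_mem s (Finset.mem_univ i))]
  | zero => exact ⟨∅, fun _ _ _ => rfl⟩
  | add g₁ g₂ _ _ h₁ h₂ =>
    obtain ⟨T₁, h₁⟩ := h₁
    obtain ⟨T₂, h₂⟩ := h₂
    refine ⟨T₁ ∪ T₂, fun x y h => ?_⟩
    rw [Pi.add_apply, Pi.add_apply,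
      h₁ x y fun i t ht => h i t (Finset.mem_union_left _ ht),
      h₂ x y fun i t ht => h i t (Finset.mem_union_right _ ht)]
  | smul c g _ h =>
    obtain ⟨T, h⟩ := h
    exact ⟨T, fun x y hxy => by rw [Pi.smul_apply, Pi.smul_apply, h x y hxy]⟩

/-- On a grid containing all thresholds of `g` inside the box, `g` is constant on each half-open
cell and equals its value at the lower corner. Hence the cut-off of `g` is a nonnegative combination
of box indicators. -/
theorem map_mul_boxInd_nonneg {n : ℕ} {L : ((Fin n → ℝ) → ℝ) →ₗ[ℝ] ℝ}
    (hL : ∀ a b : Fin n → ℝ, (∀ i, a i ≤ b i) → 0 ≤ L (boxInd a b))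
    {g : (Fin n → ℝ) → ℝ} (hg : g ∈ stepSpan n) (hg0 : 0 ≤ g) {a b : ℝ} (hab : a ≤ b) :
    0 ≤ L (g * boxInd (fun _ => a) (fun _ => b)) := by
  obtain ⟨T, hT⟩ := exists_finset_of_mem_stepSpan hg
  obtain ⟨m, t, ht, h0, hm, htT⟩ := exists_partition hab T
  have h : g * boxInd (fun _ => a) (fun _ => b) =
      ∑ p ∈ Fintype.piFinset fun _ : Fin n => Finset.range m,
        g (fun i => t (p i)) • boxInd (fun i => t (p i)) (fun i => t (p i + 1)) := by
    ext x
    rw [Pi.mul_apply, boxInd_const_eq_sum h0 hm, Finset.mul_sum, Finset.sum_apply]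
    refine Finset.sum_congr rfl fun p hp => ?_
    rw [Pi.smul_apply, smul_eq_mul, boxInd_eq_ite fun i => ht (Nat.le_succ _)]
    split_ifs with hx
    · congr 1
      refine hT _ _ fun i u hu => ?_
      have := htT u hu (p i) (Finset.mem_range.mp (Fintype.mem_piFinset.mp hp i))
      have := hx i
      grind
    · simp
  rw [h, map_sum]
  refine Finset.sum_nonneg fun p _ => ?_
  rw [map_smul, smul_eq_mul]
  exact mul_nonneg (hg0 _) (hL _ _ fun i => ht (Nat.le_succ _))

theorem orthantInd_mul_boxInd {n : ℕ} (s : Fin n → ℝ) (a : ℝ) {b : ℝ} (hb : ∀ i, s i ≤ b) :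
    orthantInd s * boxInd (fun _ => a) (fun _ => b) =
      boxInd (fun i => min (s i) a) s := by
  ext x
  simp only [Pi.mul_apply, orthantInd, boxInd, ← Finset.prod_mul_distrib, mul_sub, rayInd_mul,
    min_eq_left (hb _)]

/-- Inclusion–exclusion: `T` is the set of coordinates in which the lower endpoint is chosen. -/
theorem boxInd_eq_sum {n : ℕ} (a b : Fin n → ℝ) :
    boxInd a b = ∑ T : Finset (Fin n), (-1 : ℝ) ^ T.card • orthantInd (T.piecewise a b) := by
  ext x
  simp only [boxInd, sub_eq_neg_add]
  rw [Fintype.prod_add, Finset.sum_apply]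
  refine Finset.sum_congr rfl fun T _ => ?_
  rw [Pi.smul_apply, smul_eq_mul, orthantInd, Finset.prod_neg, mul_assoc,
    ← Finset.prod_mul_prod_compl T]
  congr 2
  · exact Finset.prod_congr rfl fun i hi => by rw [Finset.piecewise_eq_of_mem _ _ _ hi]
  · exact Finset.prod_congr rfl fun i hi => by
      rw [Finset.piecewise_eq_of_notMem _ _ _ (Finset.mem_compl.mp hi)]

/-! ### Real distribution functions and their measures. -/

/-- A real-valued `n`-dimensional distribution function. -/
structure IsDistribution {n : ℕ} (f : (Fin n → ℝ) → ℝ) : Prop where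
  nonneg : ∀ s, 0 ≤ f s
  mono : Monotone f
  left_cont : ∀ s : Fin n → ℝ,
    Tendsto (fun k : ℕ => f fun i => s i - 1 / ((k : ℝ) + 1)) atTop (𝓝 (f s))
  tendsto_zero : ∀ i s, Tendsto (fun k : ℕ => f (Function.update s i (-k))) atTop (𝓝 0)
  volume : ∀ a b : Fin n → ℝ, (∀ i, a i ≤ b i) → ∀ s, 0 ≤ iterDiff a b f s

theorem IsDistribution.tendsto_box {n : ℕ} {f : (Fin n → ℝ) → ℝ} (hf : IsDistribution f)
    {L : ((Fin n → ℝ) → ℝ) →ₗ[ℝ] ℝ} (hL : ∀ s, L (orthantInd s) = f s) (s : Fin n → ℝ) :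
    Tendsto (fun k : ℕ => L (boxInd (fun i => min (s i) (-k)) s)) atTop (𝓝 (f s)) := by
  -- Written to match inclusion–exclusion termwise: a term with some `i ∈ T` is squeezed to zero by
  -- `tendsto_zero i`, and only the full orthant survives.
  have h : f s = ∑ T : Finset (Fin n), (-1 : ℝ) ^ T.card * if T = ∅ then f s else 0 := by
    simp
  rw [h]
  simp only [boxInd_eq_sum, map_sum, map_smul, hL, smul_eq_mul]
  refine tendsto_finsetSum _ fun T _ => Tendsto.const_mul _ ?_
  split_ifs with hT
  · subst hT
    simp
  · obtain ⟨i, hi⟩ := Finset.nonempty_iff_ne_empty.mpr hT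
    refine tendsto_of_tendsto_of_tendsto_of_le_of_le tendsto_const_nhds (hf.tendsto_zero i s)
      (fun k => hf.nonneg _) fun k => hf.mono fun j => ?_
    by_cases hj : j = i
    · subst hj
      simp [Finset.piecewise_eq_of_mem _ _ _ hi]
    · rw [Function.update_of_ne hj]
      by_cases hjT : j ∈ T
      · simp [Finset.piecewise_eq_of_mem _ _ _ hjT]
      · simp [Finset.piecewise_eq_of_notMem _ _ _ hjT]

theorem IsDistribution.map_boxInd_nonneg {n : ℕ} {f : (Fin n → ℝ) → ℝ} (hf : IsDistribution f)
    {L : ((Fin n → ℝ) → ℝ) →ₗ[ℝ] ℝ} (hL : ∀ s, L (orthantInd s) = f s) (a b : Fin n → ℝ)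
    (hab : ∀ i, a i ≤ b i) : 0 ≤ L (boxInd a b) := by
  rw [map_boxInd L a b a, funext hL]
  exact hf.volume a b hab a

theorem IsDistribution.map_nonneg {n : ℕ} {f : (Fin n → ℝ) → ℝ} (hf : IsDistribution f)
    {L : ((Fin n → ℝ) → ℝ) →ₗ[ℝ] ℝ} (hL : ∀ s, L (orthantInd s) = f s)
    {g : (Fin n → ℝ) → ℝ} (hg : g ∈ stepSpan n) (hg0 : 0 ≤ g) : 0 ≤ L g := by
  have key : ∃ K₀ : ℝ, ∀ K ≥ K₀, Tendsto
      (fun k : ℕ => L (g * boxInd (fun _ => -(k : ℝ)) (fun _ => K))) atTop (𝓝 (L g)) := by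
    -- Convergence of the cut-offs is linear in `g`, while nonnegativity would not pass through the
    -- span induction.
    clear hg0
    induction hg using Submodule.span_induction with
    | mem g hg =>
      obtain ⟨s, rfl⟩ := hg
      -- The upper cut must lie above every coordinate of `s`, so that only the lower faces of the
      -- orthant are cut.
      refine ⟨∑ i, |s i|, fun K hK => ?_⟩
      have hs : ∀ i, s i ≤ K := fun i => (le_abs_self _).trans
        ((Finset.single_le_sum (f := fun i => |s i|) (fun _ _ => abs_nonneg _)
          (Finset.mem_univ i)).trans hK)
      simp only [orthantInd_mul_boxInd s _ hs, hL]
      exact hf.tendsto_box hL s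
    | zero => exact ⟨0, fun K _ => by simp⟩
    | add g₁ g₂ _ _ h₁ h₂ =>
      obtain ⟨K₁, h₁⟩ := h₁
      obtain ⟨K₂, h₂⟩ := h₂
      refine ⟨max K₁ K₂, fun K hK => ?_⟩
      simp only [add_mul, map_add]
      exact (h₁ K ((le_max_left _ _).trans hK)).add (h₂ K ((le_max_right _ _).trans hK))
    | smul c g _ h =>
      obtain ⟨K₀, h⟩ := h
      refine ⟨K₀, fun K hK => ?_⟩
      simp only [smul_mul_assoc, map_smul]
      exact (h K hK).const_smul c
  obtain ⟨K₀, hK₀⟩ := key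
  refine ge_of_tendsto (hK₀ (max K₀ 0) (le_max_left _ _)) (Eventually.of_forall fun k => ?_)
  exact map_mul_boxInd_nonneg (hf.map_boxInd_nonneg hL) hg hg0
    ((neg_nonpos.mpr (Nat.cast_nonneg k)).trans (le_max_right _ _))

theorem boxInd_mem_stepSpan {n : ℕ} (a b : Fin n → ℝ) : boxInd a b ∈ stepSpan n := by
  rw [boxInd_eq_sum]
  exact Submodule.sum_mem _ fun T _ => Submodule.smul_mem _ _ (Submodule.subset_span ⟨_, rfl⟩)

open CompactlySupported in
theorem exists_le_orthantInd {n : ℕ} (g : C_c(Fin n → ℝ, ℝ)) :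
    ∃ (s : Fin n → ℝ) (C : ℝ), ∀ x, g x ≤ C * orthantInd s x := by
  obtain ⟨R, hR⟩ := (HasCompactSupport.isCompact g.hasCompactSupport).isBounded.subset_closedBall 0
  obtain ⟨C, hC⟩ := g.continuous.bounded_above_of_compact_support g.hasCompactSupport
  refine ⟨fun _ => R + 1, C, fun x => ?_⟩
  rw [orthantInd_eq_ite]
  split_ifs with hx
  · simpa using (le_abs_self _).trans (hC x)
  · have : x ∉ tsupport g := fun h => hx fun i => by
      have h1 := hR h
      rw [mem_closedBall_zero_iff] at h1
      have h2 := (le_abs_self _).trans ((norm_le_pi_norm x i).trans h1)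
      linarith
    rw [image_eq_zero_of_notMem_tsupport this, mul_zero]

open CompactlySupported in
/-- The functional on step functions given by a distribution function extends to a positive
functional on compactly supported continuous functions. -/
theorem IsDistribution.exists_positiveLinearMap {n : ℕ} {f : (Fin n → ℝ) → ℝ}
    (hf : IsDistribution f) {L : ((Fin n → ℝ) → ℝ) →ₗ[ℝ] ℝ}
    (hL : ∀ s, L (orthantInd s) = f s) :
    ∃ Λ : C_c(Fin n → ℝ, ℝ) →ₚ[ℝ] ℝ, ∀ (g : C_c(Fin n → ℝ, ℝ)), ∀ v ∈ stepSpan n,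
      ((∀ x, g x ≤ v x) → Λ g ≤ L v) ∧ ((∀ x, v x ≤ g x) → L v ≤ Λ g) := by
  let E := stepSpan n × C_c(Fin n → ℝ, ℝ)
  -- A pair `(v, g)` stands for the function `v + g`, so `g ≤ v` becomes membership of `(v, -g)`;
  -- the two kinds of functions are thereby compared without a common space.
  let cone : PointedCone ℝ E :=
    { carrier := {p | ∀ x, 0 ≤ p.1.1 x + p.2 x}
      add_mem' := fun {p q} hp hq x => by
        have := hp x
        have := hq x
        change 0 ≤ (p.1.1 x + q.1.1 x) + (p.2 x + q.2 x)
        linarith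
      zero_mem' := fun x => by simp
      smul_mem' := fun c p hp x => by
        have := mul_nonneg c.2 (hp x)
        rw [mul_add] at this
        exact this }
  have hcone : ∀ p : E, p ∈ cone ↔ ∀ x, 0 ≤ p.1.1 x + p.2 x := fun p => Iff.rfl
  let f₀ : E →ₗ.[ℝ] ℝ :=
    { domain := LinearMap.ker (LinearMap.snd ℝ (stepSpan n) C_c(Fin n → ℝ, ℝ))
      toFun := L ∘ₗ (stepSpan n).subtype ∘ₗ (LinearMap.fst ℝ _ _) ∘ₗ Submodule.subtype _ }
  have hf₀ : ∀ p : f₀.domain, f₀ p = L p.1.1.1 := fun p => rfl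
  have hdom : ∀ v : stepSpan n, ((v, 0) : E) ∈ f₀.domain := fun v => by simp [f₀]
  obtain ⟨φ, hφ, hφ0⟩ := riesz_extension cone f₀
    (by
      rintro ⟨⟨v, g⟩, hg⟩ h
      have hg0 : g = 0 := hg
      subst hg0
      rw [hf₀]
      refine hf.map_nonneg hL v.2 fun x => ?_
      simpa using h x)
    (by
      rintro ⟨v, g⟩
      -- Cofinality for the extension theorem: `-g` is bounded by a step function, so adding a step
      -- function moves any pair into the cone.
      obtain ⟨s, C, hC⟩ := exists_le_orthantInd (-g)
      refine ⟨⟨(-v + C • ⟨orthantInd s, Submodule.subset_span ⟨s, rfl⟩⟩, 0), hdom _⟩,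
        fun x => ?_⟩
      have := hC x
      simp only [CompactlySupportedContinuousMap.coe_neg, Pi.neg_apply] at this
      change 0 ≤ (-v.1 x + C * orthantInd s x + v.1 x) + (0 + g x)
      linarith)
  have hv : ∀ v : stepSpan n, φ (v, 0) = L v := fun v => hφ ⟨(v, 0), hdom v⟩
  refine ⟨PositiveLinearMap.mk₀ (φ ∘ₗ LinearMap.inr ℝ (stepSpan n) C_c(Fin n → ℝ, ℝ))
    fun g hg => hφ0 _ ((hcone _).mpr fun x => by
      change 0 ≤ (0 : ℝ) + g x
      simpa using hg x),
    fun g v hv' => ⟨fun h => ?_, fun h => ?_⟩⟩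
  · have h1 := hφ0 ((⟨v, hv'⟩, -g) : E) ((hcone _).mpr fun x => by simpa using h x)
    have h2 : ((⟨v, hv'⟩, -g) : E) = (⟨v, hv'⟩, 0) - (0, g) := by simp
    rw [h2, map_sub, hv] at h1
    exact sub_nonneg.mp h1
  · have h1 := hφ0 ((-⟨v, hv'⟩, g) : E) ((hcone _).mpr fun x => by simpa using h x)
    have h2 : ((-⟨v, hv'⟩, g) : E) = (0, g) - (⟨v, hv'⟩, 0) := by simp
    rw [h2, map_sub, hv] at h1
    exact sub_nonneg.mp h1

theorem isOpen_lowerOrthant {n : ℕ} (s : Fin n → ℝ) : IsOpen (lowerOrthant s).1 :=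
  isOpen_set_pi Set.finite_univ fun _ _ => isOpen_Iio

theorem mem_lowerOrthant {n : ℕ} {s x : Fin n → ℝ} :
    x ∈ (lowerOrthant s).1 ↔ ∀ i, x i < s i := by
  simp [lowerOrthant]

open CompactlySupported in
theorem exists_urysohn_lowerOrthant {n : ℕ} {s : Fin n → ℝ} {K : Set (Fin n → ℝ)}
    (hK : IsCompact K) (hKs : K ⊆ (lowerOrthant s).1) :
    ∃ g : C_c(Fin n → ℝ, ℝ), (∀ x ∈ K, g x = 1) ∧ (∀ x, 0 ≤ g x) ∧ ∀ x, g x ≤ orthantInd s x := by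
  obtain ⟨g, h1, h2, h3, h4⟩ := exists_continuous_one_zero_of_isCompact hK
    (isOpen_lowerOrthant s).isClosed_compl (Set.disjoint_compl_right_iff_subset.mpr hKs)
  refine ⟨⟨g, h3⟩, fun x hx => h1 hx, fun x => (h4 x).1, fun x => ?_⟩
  rw [orthantInd_eq_ite]
  split_ifs with hx
  · exact (h4 x).2
  · exact (h2 (fun h => hx (mem_lowerOrthant.mp h))).le

/-- A distribution function is the distribution function of a measure. -/
theorem IsDistribution.exists_measure {n : ℕ} {f : (Fin n → ℝ) → ℝ} (hf : IsDistribution f) :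
    ∃ μ : Measure (Fin n → ℝ), ∀ s, μ (lowerOrthant s).1 = ENNReal.ofReal (f s) := by
  obtain ⟨L, hL⟩ := exists_linearMap_orthantInd f
  obtain ⟨Λ, hΛ⟩ := hf.exists_positiveLinearMap hL
  refine ⟨RealRMK.rieszMeasure Λ, fun s => ?_⟩
  have hupper : RealRMK.rieszMeasure Λ (lowerOrthant s).1 ≤ ENNReal.ofReal (f s) := by
    rw [(isOpen_lowerOrthant s).measure_eq_iSup_isCompact]
    refine iSup₂_le fun K hKs => iSup_le fun hK => ?_
    obtain ⟨g, h1, h2, h3⟩ := exists_urysohn_lowerOrthant hK hKs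
    refine (RealRMK.rieszMeasure_le_of_eq_one Λ h2 hK h1).trans (ENNReal.ofReal_le_ofReal ?_)
    rw [← hL s]
    exact (hΛ g _ (Submodule.subset_span ⟨s, rfl⟩)).1 h3
  refine le_antisymm hupper ?_
  have hfin : RealRMK.rieszMeasure Λ (lowerOrthant s).1 ≠ ⊤ :=
    (hupper.trans_lt ENNReal.ofReal_lt_top).ne
  rw [ENNReal.ofReal_le_iff_le_toReal hfin]
  -- Left continuity moves the corner inwards to `r < s`. The closed box from `a` to `r` is then
  -- compact inside the open orthant, leaving room for a continuous function between the two
  -- indicators.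
  refine le_of_tendsto (hf.left_cont s) (Eventually.of_forall fun j => ?_)
  refine le_of_tendsto (hf.tendsto_box hL _) (Eventually.of_forall fun k => ?_)
  set r : Fin n → ℝ := fun i => s i - 1 / ((j : ℝ) + 1) with hr
  have hrs : ∀ i, r i < s i := fun i => sub_lt_self _ (by positivity)
  set a : Fin n → ℝ := fun i => min (r i) (-k) with ha
  obtain ⟨g, h1, h2, h3⟩ := exists_urysohn_lowerOrthant (s := s) (isCompact_Icc (a := a) (b := r))
    fun x hx => mem_lowerOrthant.mpr fun i => (hx.2 i).trans_lt (hrs i)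
  have h4 : L (boxInd a r) ≤ Λ g := by
    refine (hΛ g _ (boxInd_mem_stepSpan a r)).2 fun x => ?_
    rw [boxInd_eq_ite fun i => min_le_left _ _]
    split_ifs with hx
    · exact (h1 x ⟨fun i => (hx i).1, fun i => (hx i).2.le⟩).ge
    · exact h2 x
  refine h4.trans ?_
  rw [← RealRMK.integral_rieszMeasure Λ g, ← measureReal_def,
    ← integral_indicator_one (isOpen_lowerOrthant s).measurableSet]
  refine integral_mono g.integrable ?_ fun x => (h3 x).trans_eq ?_
  · exact (integrable_indicator_iff (isOpen_lowerOrthant s).measurableSet).mpr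
      (integrableOn_const hfin)
  · rw [orthantInd_eq_ite]
    split_ifs with hx
    · rw [Set.indicator_of_mem (mem_lowerOrthant.mpr hx), Pi.one_apply]
    · rw [Set.indicator_of_notMem fun h => hx (mem_lowerOrthant.mp h)]

/-! ### Orthants as a generating π-system. -/

theorem generateFrom_lowerOrthant (n : ℕ) :
    (inferInstance : MeasurableSpace (Fin n → ℝ)) =
      MeasurableSpace.generateFrom (Set.range fun s : Fin n → ℝ => (lowerOrthant s).1) := by
  have h := generateFrom_eq_pi (C := fun _ : Fin n => Set.range (Set.Iio : ℝ → Set ℝ))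
    (fun _ => (borel_eq_generateFrom_Iio ℝ).symm.trans (BorelSpace.measurable_eq (α := ℝ)).symm)
    (fun _ => ⟨fun k : ℕ => Set.Iio (k : ℝ), fun k => ⟨k, rfl⟩,
      Set.eq_univ_of_forall fun x => by
        obtain ⟨k, hk⟩ := exists_nat_gt x
        exact Set.mem_iUnion.mpr ⟨k, hk⟩⟩)
  refine h.symm.trans (congrArg _ ?_)
  ext A
  constructor
  · rintro ⟨B, hB, rfl⟩
    choose s hs using fun i => hB i (Set.mem_univ i)
    exact ⟨s, by simp only [lowerOrthant, hs]⟩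
  · rintro ⟨s, rfl⟩
    exact ⟨fun i => Set.Iio (s i), fun i _ => ⟨s i, rfl⟩, rfl⟩

theorem isPiSystem_lowerOrthant (n : ℕ) :
    IsPiSystem (Set.range fun s : Fin n → ℝ => (lowerOrthant s).1) := by
  rintro _ ⟨s, rfl⟩ _ ⟨t, rfl⟩ -
  refine ⟨fun i => min (s i) (t i), ?_⟩
  ext x
  simp only [Set.mem_inter_iff, mem_lowerOrthant, lt_min_iff, forall_and]

/-! ### Order suprema and infima in `E` versus scalar limits. -/

/-- The set `E` is closed under `a ↦ 1 - a`, under sums bounded by `1` and under limits of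
monotone sequences, and its order is determined by the additive functionals `q`, which are
continuous along monotone sequences. -/
structure IsMonotoneDetermined {G ι : Type*} [AddCommGroup G] [One G] [PartialOrder G]
    (E : Set G) (q : ι → G →+ ℝ) : Prop where
  one_mem : 1 ∈ E
  one_sub_mem : ∀ {a}, a ∈ E → 1 - a ∈ E
  nonneg_of_mem : ∀ {a}, a ∈ E → 0 ≤ a
  map_nonneg : ∀ {a : G}, 0 ≤ a → ∀ v, 0 ≤ q v a
  le_iff : ∀ {a b}, a ∈ E → b ∈ E → (a ≤ b ↔ ∀ v, q v a ≤ q v b)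
  add_mem : ∀ {a b}, a ∈ E → b ∈ E → (∀ v, q v (a + b) ≤ q v 1) → a + b ∈ E
  exists_tendsto : ∀ T : ℕ → G, (∀ k, T k ∈ E) → (∀ v, Monotone fun k => q v (T k)) →
    ∃ a ∈ E, ∀ v, Tendsto (fun k => q v (T k)) atTop (𝓝 (q v a))

namespace IsMonotoneDetermined

variable {G ι : Type*} [AddCommGroup G] [One G] [PartialOrder G] {E : Set G} {q : ι → G →+ ℝ}

theorem ext (h : IsMonotoneDetermined E q) {a b : G} (ha : a ∈ E) (hb : b ∈ E)
    (hab : ∀ v, q v a = q v b) : a = b :=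
  le_antisymm ((h.le_iff ha hb).mpr fun v => (hab v).le) ((h.le_iff hb ha).mpr fun v => (hab v).ge)

theorem zero_mem (h : IsMonotoneDetermined E q) : 0 ∈ E := by
  simpa using h.one_sub_mem h.one_mem

theorem isSupIn_of_tendsto (h : IsMonotoneDetermined E q) {T : ℕ → G} {a : G}
    (hT : ∀ k, T k ∈ E) (hmono : ∀ v, Monotone fun k => q v (T k)) (ha : a ∈ E)
    (hlim : ∀ v, Tendsto (fun k => q v (T k)) atTop (𝓝 (q v a))) : IsSupIn E (Set.range T) a := by
  refine ⟨⟨ha, ?_⟩, fun b hb => (h.le_iff ha hb.1).mpr fun v => ?_⟩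
  · rintro _ ⟨k, rfl⟩
    exact (h.le_iff (hT k) ha).mpr fun v => (hmono v).ge_of_tendsto (hlim v) k
  · exact le_of_tendsto (hlim v) (Eventually.of_forall fun k =>
      (h.le_iff (hT k) hb.1).mp (hb.2 ⟨k, rfl⟩) v)

/-- The scalar limits are represented by some `b ∈ E`, which is then a supremum in `E`; suprema are
unique, so `b = a`. -/
theorem tendsto_of_isSupIn (h : IsMonotoneDetermined E q) {T : ℕ → G} {a : G}
    (hT : ∀ k, T k ∈ E) (hmono : Monotone T) (ha : IsSupIn E (Set.range T) a) (v : ι) :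
    Tendsto (fun k => q v (T k)) atTop (𝓝 (q v a)) := by
  have hmono' : ∀ v, Monotone fun k => q v (T k) := fun v i j hij =>
    (h.le_iff (hT i) (hT j)).mp (hmono hij) v
  obtain ⟨b, hb, hlim⟩ := h.exists_tendsto T hT hmono'
  rw [ha.unique (h.isSupIn_of_tendsto hT hmono' hb hlim)]
  exact hlim v

theorem tendsto_of_isInfIn_zero (h : IsMonotoneDetermined E q) {T : ℕ → G}
    (hT : ∀ k, T k ∈ E) (hanti : Antitone T) (h0 : IsInfIn E (Set.range T) 0) (v : ι) :
    Tendsto (fun k => q v (T k)) atTop (𝓝 0) := by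
  have hanti' : ∀ v, Antitone fun k => q v (T k) := fun v i j hij =>
    (h.le_iff (hT j) (hT i)).mp (hanti hij) v
  -- Complementation turns the decreasing sequence into an increasing one; `1 - b` is then a lower
  -- bound in `E`, hence zero.
  obtain ⟨b, hb, hlim⟩ := h.exists_tendsto (fun k => 1 - T k) (fun k => h.one_sub_mem (hT k))
    fun v i j hij => by
      simp only [map_sub]
      exact sub_le_sub_left (hanti' v hij) _
  have hlim' : ∀ v, Tendsto (fun k => q v (T k)) atTop (𝓝 (q v (1 - b))) := fun v => by
    have := (hlim v).const_sub (q v 1)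
    simpa using this
  have hle : 1 - b ≤ 0 := h0.2 ⟨h.one_sub_mem hb, by
    rintro _ ⟨k, rfl⟩
    exact (h.le_iff (h.one_sub_mem hb) (hT k)).mpr fun v => (hanti' v).le_of_tendsto (hlim' v) k⟩
  have heq : 1 - b = 0 := le_antisymm hle (h.nonneg_of_mem (h.one_sub_mem hb))
  simpa [heq] using hlim' v

end IsMonotoneDetermined

/-- Reduces suprema over real parameters to suprema over a cofinal sequence. -/
theorem IsSupIn.congr {G : Type*} [PartialOrder G] {E S S' : Set G} {a : G} (h : IsSupIn E S a)
    (h1 : S' ⊆ S) (h2 : ∀ x ∈ S, ∃ y ∈ S', x ≤ y) : IsSupIn E S' a := by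
  have : upperBounds S' = upperBounds S := by
    refine Set.Subset.antisymm (fun b hb x hx => ?_) (upperBounds_mono_set h1)
    obtain ⟨y, hy, hxy⟩ := h2 x hx
    exact hxy.trans (hb hy)
  rwa [IsSupIn, this]

theorem IsInfIn.congr {G : Type*} [PartialOrder G] {E S S' : Set G} {a : G} (h : IsInfIn E S a)
    (h1 : S' ⊆ S) (h2 : ∀ x ∈ S, ∃ y ∈ S', y ≤ x) : IsInfIn E S' a := by
  have : lowerBounds S' = lowerBounds S := by
    refine Set.Subset.antisymm (fun b hb x hx => ?_) (lowerBounds_mono_set h1)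
    obtain ⟨y, hy, hxy⟩ := h2 x hx
    exact (hb hy).trans hxy
  rwa [IsInfIn, this]

/-! ### Scalar measures of a spectral resolution and the elements representing them. -/

namespace SpectralResolution

variable {G ι : Type*} [AddCommGroup G] [One G] [PartialOrder G] {E : Set G} {q : ι → G →+ ℝ}
  {n : ℕ}

theorem isDistribution (F : SpectralResolution E n) (h : IsMonotoneDetermined E q) (v : ι) :
    IsDistribution fun s => q v (F.toFun s) where
  nonneg s := h.map_nonneg (h.nonneg_of_mem (F.mem s)) v
  mono s t hst := (h.le_iff (F.mem s) (F.mem t)).mp (F.mono s t hst) v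
  left_cont t := by
    refine h.tendsto_of_isSupIn (fun k => F.mem _) (fun i j hij => F.mono _ _ fun l => ?_)
      ((F.left_cont t).congr ?_ ?_) v
    · exact sub_le_sub_left (Nat.one_div_le_one_div hij) _
    · rintro _ ⟨k, rfl⟩
      exact ⟨_, fun i => sub_lt_self _ Nat.one_div_pos_of_nat, rfl⟩
    · rintro _ ⟨s, hs, rfl⟩
      have hev : ∀ᶠ k : ℕ in atTop, ∀ i, s i ≤ t i - 1 / ((k : ℝ) + 1) := by
        rw [eventually_all]
        intro i
        have := (tendsto_one_div_add_atTop_nhds_zero_nat (𝕜 := ℝ)).const_sub (t i)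
        rw [sub_zero] at this
        exact (this.eventually (lt_mem_nhds (hs i))).mono fun _ => le_of_lt
      obtain ⟨k, hk⟩ := hev.exists
      exact ⟨_, ⟨k, rfl⟩, F.mono _ _ hk⟩
  tendsto_zero i s := by
    refine h.tendsto_of_isInfIn_zero (fun k => F.mem _) (fun k l hkl => F.mono _ _ fun j => ?_)
      ((F.inf_eq_zero i s).congr ?_ ?_) v
    · have h := Function.update_mono (f := s) (i := i) (neg_le_neg (Nat.cast_le (α := ℝ).mpr hkl))
      exact h j
    · rintro _ ⟨k, rfl⟩
      exact ⟨_, rfl⟩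
    · rintro _ ⟨t, rfl⟩
      obtain ⟨k, hk⟩ := exists_nat_ge (-t)
      exact ⟨_, ⟨k, rfl⟩, F.mono _ _ (Function.update_mono (f := s) (i := i) (neg_le.mp hk))⟩
  volume a b hab s := by
    rw [← map_iterDiff (q v)]
    exact h.map_nonneg (F.volume a b hab s) v

theorem tendsto_one (F : SpectralResolution E n) (h : IsMonotoneDetermined E q) (v : ι) :
    Tendsto (fun k : ℕ => q v (F.toFun fun _ => k)) atTop (𝓝 (q v 1)) := by
  refine h.tendsto_of_isSupIn (fun k => F.mem _)
    (fun k l hkl => F.mono _ _ fun j => Nat.cast_le.mpr hkl) (F.sup_eq_one.congr ?_ ?_) v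
  · rintro _ ⟨k, rfl⟩
    exact ⟨_, rfl⟩
  · rintro _ ⟨s, rfl⟩
    obtain ⟨k, hk⟩ := exists_nat_ge (∑ i, |s i|)
    exact ⟨_, ⟨k, rfl⟩, F.mono _ _ fun j => (le_abs_self _).trans
      ((Finset.single_le_sum (f := fun i => |s i|) (fun _ _ => abs_nonneg _)
        (Finset.mem_univ j)).trans hk)⟩

theorem exists_measure (F : SpectralResolution E n) (h : IsMonotoneDetermined E q) (v : ι) :
    ∃ μ : Measure (Fin n → ℝ), IsFiniteMeasure μ ∧ μ.real Set.univ = q v 1 ∧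
      ∀ s, μ.real (lowerOrthant s).1 = q v (F.toFun s) := by
  obtain ⟨μ, hμ⟩ := (F.isDistribution h v).exists_measure
  have hU : (⋃ k : ℕ, (lowerOrthant fun _ : Fin n => (k : ℝ)).1) = Set.univ := by
    refine Set.eq_univ_of_forall fun x => ?_
    obtain ⟨k, hk⟩ := exists_nat_gt (∑ i, |x i|)
    exact Set.mem_iUnion.mpr ⟨k, mem_lowerOrthant.mpr fun j => (le_abs_self _).trans_lt
      ((Finset.single_le_sum (f := fun i => |x i|) (fun _ _ => abs_nonneg _)
        (Finset.mem_univ j)).trans_lt hk)⟩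
  have hmono : Monotone fun k : ℕ => (lowerOrthant fun _ : Fin n => (k : ℝ)).1 :=
    fun k l hkl x hx => mem_lowerOrthant.mpr fun i =>
      (mem_lowerOrthant.mp hx i).trans_le (Nat.cast_le.mpr hkl)
  have h1 := tendsto_measure_iUnion_atTop (μ := μ) hmono
  rw [hU] at h1
  have h2 : μ Set.univ = ENNReal.ofReal (q v 1) := by
    refine tendsto_nhds_unique h1 ?_
    simp only [Function.comp_def, hμ]
    exact (ENNReal.continuous_ofReal.tendsto _).comp (F.tendsto_one h v)
  refine ⟨μ, ⟨by rw [h2]; exact ENNReal.ofReal_lt_top⟩, ?_, fun s => ?_⟩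
  · rw [measureReal_def, h2,
      ENNReal.toReal_ofReal (h.map_nonneg (h.nonneg_of_mem h.one_mem) v)]
  · rw [measureReal_def, hμ, ENNReal.toReal_ofReal ((F.isDistribution h v).nonneg s)]

/-- The family of scalar measures of a spectral resolution is represented by elements of `E`. -/
theorem exists_mem_map_eq_measureReal (F : SpectralResolution E n)
    (h : IsMonotoneDetermined E q) {μ : ι → Measure (Fin n → ℝ)} [∀ v, IsFiniteMeasure (μ v)]
    (huniv : ∀ v, (μ v).real Set.univ = q v 1)
    (hμ : ∀ v s, (μ v).real (lowerOrthant s).1 = q v (F.toFun s)) (A : Set (Fin n → ℝ))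
    (hA : MeasurableSet A) : ∃ a ∈ E, ∀ v, q v a = (μ v).real A := by
  induction A, hA using MeasurableSpace.induction_on_inter (generateFrom_lowerOrthant n)
    (isPiSystem_lowerOrthant n) with
  | empty => exact ⟨0, h.zero_mem, fun v => by simp⟩
  | basic A hA =>
    obtain ⟨s, rfl⟩ := hA
    exact ⟨F.toFun s, F.mem s, fun v => (hμ v s).symm⟩
  | compl A hA ih =>
    obtain ⟨a, ha, haμ⟩ := ih
    exact ⟨1 - a, h.one_sub_mem ha, fun v => by
      rw [map_sub, measureReal_compl hA, huniv, haμ]⟩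
  | iUnion A hdisj hA ih =>
    have hpart : ∀ N : ℕ, ∃ a ∈ E, ∀ v, q v a = (μ v).real (⋃ i < N, A i) := by
      intro N
      induction N with
      | zero => exact ⟨0, h.zero_mem, fun v => by simp⟩
      | succ N ihN =>
        obtain ⟨a, ha, haμ⟩ := ihN
        obtain ⟨b, hb, hbμ⟩ := ih N
        have hq : ∀ v, q v (a + b) = (μ v).real (⋃ i < N + 1, A i) := fun v => by
          rw [Set.biUnion_lt_succ, measureReal_union ?_ (hA N) (measure_ne_top _ _)
            (measure_ne_top _ _), map_add, haμ, hbμ]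
          exact Set.disjoint_iUnion₂_left.mpr fun i hi => hdisj hi.ne
        -- Disjointness bounds the sum of the forms by the total mass `q v 1`, which is what
        -- membership of `a + b` in `E` requires.
        refine ⟨a + b, h.add_mem ha hb fun v => ?_, hq⟩
        rw [hq, ← huniv]
        exact measureReal_mono (Set.subset_univ _)
    choose a ha haμ using hpart
    have hmono : Monotone fun N : ℕ => ⋃ i < N, A i := fun N M hNM =>
      Set.biUnion_subset_biUnion_left fun i hi => lt_of_lt_of_le hi hNM
    obtain ⟨b, hb, hlim⟩ := h.exists_tendsto a ha fun v N M hNM => by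
      simp only [haμ]
      exact measureReal_mono (hmono hNM) (measure_ne_top _ _)
    refine ⟨b, hb, fun v => tendsto_nhds_unique (hlim v) ?_⟩
    have hU : ⋃ N : ℕ, ⋃ i < N, A i = ⋃ i, A i := by
      ext x
      simp only [Set.mem_iUnion]
      exact ⟨fun ⟨_, i, _, hi⟩ => ⟨i, hi⟩, fun ⟨i, hi⟩ => ⟨i + 1, i, i.lt_succ_self, hi⟩⟩
    have := tendsto_measure_iUnion_atTop (μ := μ v) hmono
    rw [hU] at this
    simp only [haμ]
    exact (ENNReal.tendsto_toReal (measure_ne_top _ _)).comp this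

end SpectralResolution

/-! ### Uniqueness of observables. -/

namespace Observable

variable {G : Type*} [AddCommGroup G] [One G] [PartialOrder G] {E : Set G} {n : ℕ}

theorem map_empty (x : Observable E n) : x.toFun ⟨∅, MeasurableSet.empty⟩ = 0 := by
  have := x.map_union ∅ ∅ MeasurableSet.empty MeasurableSet.empty (Set.inter_self _)
  simpa using this

theorem map_compl (x : Observable E n) (A : Set (Fin n → ℝ)) (hA : MeasurableSet A) :
    x.toFun ⟨Aᶜ, hA.compl⟩ = 1 - x.toFun ⟨A, hA⟩ := by
  have := x.map_union A Aᶜ hA hA.compl (Set.inter_compl_self A)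
  simp only [Set.union_compl_self, x.map_univ] at this
  rw [this, add_sub_cancel_left]

/-- π-λ induction inside `G` itself: complements and finite disjoint unions by additivity, countable
ones by uniqueness of suprema. No scalar functionals are involved. -/
theorem ext_of_lowerOrthant {x y : Observable E n}
    (hxy : ∀ s, x.toFun (lowerOrthant s) = y.toFun (lowerOrthant s)) : x = y := by
  have key : ∀ (A : Set (Fin n → ℝ)) (hA : MeasurableSet A),
      x.toFun ⟨A, hA⟩ = y.toFun ⟨A, hA⟩ := by
    intro A hA
    induction A, hA using MeasurableSpace.induction_on_inter (generateFrom_lowerOrthant n)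
      (isPiSystem_lowerOrthant n) with
    | empty => rw [map_empty, map_empty]
    | basic A hA =>
      obtain ⟨s, rfl⟩ := hA
      exact hxy s
    | compl A hA ih => rw [x.map_compl A hA, y.map_compl A hA, ih]
    | iUnion A hdisj hA ih =>
      have hB : ∀ N : ℕ, MeasurableSet (⋃ i < N, A i) := fun N =>
        MeasurableSet.iUnion fun i => MeasurableSet.iUnion fun _ => hA i
      have hpart : ∀ N : ℕ, x.toFun ⟨⋃ i < N, A i, hB N⟩ = y.toFun ⟨⋃ i < N, A i, hB N⟩ := by
        intro N
        induction N with
        | zero =>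
          have h0 : (⟨⋃ i < 0, A i, hB 0⟩ : {A : Set (Fin n → ℝ) // MeasurableSet A}) =
              ⟨∅, MeasurableSet.empty⟩ := Subtype.ext (by simp)
          rw [h0, map_empty, map_empty]
        | succ N ihN =>
          have hS : (⟨⋃ i < N + 1, A i, hB (N + 1)⟩ :
              {A : Set (Fin n → ℝ) // MeasurableSet A}) =
              ⟨(⋃ i < N, A i) ∪ A N, (hB N).union (hA N)⟩ :=
            Subtype.ext (Set.biUnion_lt_succ A N)
          have hd : (⋃ i < N, A i) ∩ A N = ∅ :=
            (Set.disjoint_iUnion₂_left.mpr fun i (hi : i < N) => hdisj hi.ne).inter_eq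
          rw [hS, x.map_union _ _ (hB N) (hA N) hd, y.map_union _ _ (hB N) (hA N) hd, ihN, ih N]
      have hmono : Monotone fun N : ℕ => ⋃ i < N, A i := fun N M hNM =>
        Set.biUnion_subset_biUnion_left fun i hi => lt_of_lt_of_le hi hNM
      have hU : (⟨⋃ i, A i, MeasurableSet.iUnion hA⟩ :
          {A : Set (Fin n → ℝ) // MeasurableSet A}) =
          ⟨⋃ N : ℕ, ⋃ i < N, A i, MeasurableSet.iUnion hB⟩ := by
        refine Subtype.ext ?_
        ext x
        simp only [Set.mem_iUnion]
        exact ⟨fun ⟨i, hi⟩ => ⟨i + 1, i, i.lt_succ_self, hi⟩, fun ⟨_, i, _, hi⟩ => ⟨i, hi⟩⟩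
      have hx := x.map_iUnion _ hB hmono
      have hy := y.map_iUnion _ hB hmono
      simp only [hpart] at hx
      rw [hU]
      exact hx.unique hy
  cases x
  cases y
  congr
  ext A
  exact key A.1 A.2

end Observable

/-- Every spectral resolution on a monotonically determined `E` comes from a unique observable. -/
theorem IsMonotoneDetermined.existsUnique_observable {G ι : Type*} [AddCommGroup G] [One G]
    [PartialOrder G] {E : Set G} {q : ι → G →+ ℝ} (h : IsMonotoneDetermined E q) {n : ℕ}
    (F : SpectralResolution E n) :
    ∃! x : Observable E n, ∀ s, F.toFun s = x.toFun (lowerOrthant s) := by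
  choose μ hfin huniv hμ using F.exists_measure h
  choose X hXE hX using F.exists_mem_map_eq_measureReal h huniv hμ
  have hx : ∃ x : Observable E n, ∀ A, x.toFun A = X A.1 A.2 := by
    refine ⟨⟨fun A => X A.1 A.2, fun A => hXE _ _, ?_, ?_, ?_⟩, fun A => rfl⟩
    · exact h.ext (hXE _ _) h.one_mem fun v => by rw [hX, huniv]
    · intro A B hA hB hAB
      have hsum : ∀ v, q v (X A hA + X B hB) = (μ v).real (A ∪ B) := fun v => by
        rw [map_add, hX, hX, measureReal_union (Set.disjoint_iff_inter_eq_empty.mpr hAB) hB]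
      refine h.ext (hXE _ _) (h.add_mem (hXE _ _) (hXE _ _) fun v => ?_) fun v => ?_
      · rw [hsum, ← huniv]
        exact measureReal_mono (Set.subset_univ _)
      · rw [hsum, hX]
    · intro A hA hmono
      refine h.isSupIn_of_tendsto (fun k => hXE _ _) (fun v i j hij => ?_) (hXE _ _) fun v => ?_
      · simp only [hX]
        exact measureReal_mono (hmono hij)
      · simp only [hX]
        exact (ENNReal.tendsto_toReal (measure_ne_top _ _)).comp
          (tendsto_measure_iUnion_atTop hmono)
  obtain ⟨x, hx⟩ := hx
  have hF : ∀ s, F.toFun s = x.toFun (lowerOrthant s) := fun s =>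
    h.ext (F.mem s) (x.mem _) fun v => by rw [hx, hX, hμ]
  exact ⟨x, hF, fun y hy => Observable.ext_of_lowerOrthant fun s => by rw [← hy s, hF s]⟩

/-! ### Symmetric operators over a ring acting on a real Hilbert space -/

section RealSymmetric

variable {R H : Type*} [Ring R] [NormedAddCommGroup H] [InnerProductSpace ℝ H] [Module R H]

/-- The quadratic form `T ↦ ⟪T v, v⟫`. -/
def quadForm (R : Type*) {H : Type*} [Ring R] [NormedAddCommGroup H] [InnerProductSpace ℝ H]
    [Module R H] (v : H) : (H →L[R] H) →+ ℝ where
  toFun T := inner ℝ (T v) v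
  map_zero' := by simp
  map_add' S T := by simp [inner_add_left]

theorem quadForm_apply (T : H →L[R] H) (v : H) : quadForm R v T = inner ℝ (T v) v := rfl

/-- The operator `T` is symmetric for the real inner product. -/
def IsRealSymmetric (T : H →L[R] H) : Prop := ∀ x y : H, inner ℝ (T x) y = inner ℝ x (T y)

theorem IsRealSymmetric.add {S T : H →L[R] H} (hS : IsRealSymmetric S)
    (hT : IsRealSymmetric T) : IsRealSymmetric (S + T) :=
  fun x y => by simp [inner_add_left, inner_add_right, hS x y, hT x y]

theorem IsRealSymmetric.sub {S T : H →L[R] H} (hS : IsRealSymmetric S)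
    (hT : IsRealSymmetric T) : IsRealSymmetric (S - T) :=
  fun x y => by simp [inner_sub_left, inner_sub_right, hS x y, hT x y]

theorem isRealSymmetric_one : IsRealSymmetric (1 : H →L[R] H) := fun _ _ => rfl

theorem quadForm_one (v : H) : quadForm R v 1 = ‖v‖ ^ 2 := by
  simp [quadForm_apply]

variable (R H) in
/-- The symmetric operators with quadratic form between `0` and `‖v‖ ^ 2`. -/
def symmEffects : Set (H →L[R] H) :=
  {T | IsRealSymmetric T ∧ ∀ v, 0 ≤ quadForm R v T ∧ quadForm R v T ≤ ‖v‖ ^ 2}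

variable (R H) in
/-- The symmetric idempotent operators. -/
def symmProjections : Set (H →L[R] H) :=
  {T | IsRealSymmetric T ∧ T * T = T}

/-- This is `T² ≤ T`: expand `0 ≤ ⟪T (v - T v), v - T v⟫` and bound `⟪T (T v), T v⟫` by `‖T v‖ ^ 2`.
-/
theorem norm_sq_apply_le_quadForm {T : H →L[R] H} (hT : T ∈ symmEffects R H) (v : H) :
    ‖T v‖ ^ 2 ≤ quadForm R v T := by
  have h1 := (hT.2 (v - T v)).1
  have h2 := (hT.2 (T v)).2
  have h3 : inner ℝ (T (T v)) v = inner ℝ (T v) (T v) := hT.1 _ _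
  rw [quadForm_apply, map_sub, inner_sub_left, inner_sub_right, inner_sub_right, h3,
    real_inner_self_eq_norm_sq] at h1
  rw [quadForm_apply] at h2 ⊢
  linarith

theorem quadForm_of_mem_symmProjections {T : H →L[R] H} (hT : T ∈ symmProjections R H) (v : H) :
    quadForm R v T = ‖T v‖ ^ 2 := by
  have h : T (T v) = T v := DFunLike.congr_fun hT.2 v
  rw [quadForm_apply, ← real_inner_self_eq_norm_sq, ← hT.1, h]

theorem symmProjections_subset_symmEffects : symmProjections R H ⊆ symmEffects R H := by
  intro T hT
  refine ⟨hT.1, fun v => ?_⟩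
  have h := quadForm_of_mem_symmProjections hT v
  refine ⟨h ▸ sq_nonneg _, ?_⟩
  have h2 := real_inner_le_norm (T v) v
  rw [← quadForm_apply] at h2
  rw [h] at h2 ⊢
  nlinarith [norm_nonneg (T v), norm_nonneg v, sq_nonneg (‖T v‖ - ‖v‖)]

theorem one_mem_symmEffects : 1 ∈ symmEffects R H :=
  ⟨isRealSymmetric_one, fun v => by rw [quadForm_one]; exact ⟨sq_nonneg _, le_rfl⟩⟩

theorem one_mem_symmProjections : 1 ∈ symmProjections R H :=
  ⟨isRealSymmetric_one, one_mul 1⟩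

theorem tendsto_of_monotone_quadForm [CompleteSpace H] {T : ℕ → H →L[R] H}
    (hT : ∀ k, T k ∈ symmEffects R H) (hmono : ∀ v, Monotone fun k => quadForm R v (T k)) (x : H) :
    ∃ y, Tendsto (fun k => T k x) atTop (𝓝 y) := by
  have hbdd : BddAbove (Set.range fun k => quadForm R x (T k)) := ⟨‖x‖ ^ 2, by
    rintro _ ⟨k, rfl⟩
    exact ((hT k).2 x).2⟩
  have hlim := tendsto_atTop_ciSup (hmono x) hbdd
  set l := ⨆ k, quadForm R x (T k) with hl
  have hsqrt : Tendsto (fun k => √(l - quadForm R x (T k))) atTop (𝓝 0) := by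
    have h := (hlim.const_sub l).sqrt
    rwa [sub_self, Real.sqrt_zero] at h
  refine cauchySeq_tendsto_of_complete (cauchySeq_of_le_tendsto_0' _ (fun i j hij => ?_) hsqrt)
  -- The difference is again an effect, so `‖(T j - T i) x‖ ^ 2` is at most the increment of the
  -- convergent form at `x`; this makes the sequence strongly Cauchy.
  have hD : T j - T i ∈ symmEffects R H := ⟨(hT j).1.sub (hT i).1, fun v => by
    rw [map_sub]
    have h1 := hmono v hij
    have h2 := ((hT i).2 v).1
    have h3 := ((hT j).2 v).2
    simp only at h1
    constructor <;> linarith⟩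
  rw [dist_comm, dist_eq_norm]
  refine Real.le_sqrt_of_sq_le ?_
  have h := norm_sq_apply_le_quadForm hD x
  rw [map_sub, sub_apply] at h
  exact h.trans (sub_le_sub_right (le_ciSup hbdd j) _)

theorem exists_tendsto_of_monotone_quadForm [CompleteSpace H] [ContinuousConstSMul R H]
    {T : ℕ → H →L[R] H} (hT : ∀ k, T k ∈ symmEffects R H)
    (hmono : ∀ v, Monotone fun k => quadForm R v (T k)) :
    ∃ S ∈ symmEffects R H, ∀ x, Tendsto (fun k => T k x) atTop (𝓝 (S x)) := by
  choose f hf using tendsto_of_monotone_quadForm hT hmono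
  let S₀ : H →ₗ[R] H := linearMapOfTendsto f (fun k => (T k : H →ₗ[R] H)) (tendsto_pi_nhds.mpr hf)
  have hnorm : ∀ x, ‖f x‖ ≤ 1 * ‖x‖ := fun x => by
    rw [one_mul]
    refine le_of_tendsto (hf x).norm (Eventually.of_forall fun k => ?_)
    have h := (norm_sq_apply_le_quadForm (hT k) x).trans ((hT k).2 x).2
    exact (sq_le_sq₀ (norm_nonneg _) (norm_nonneg _)).mp h
  let S : H →L[R] H := ⟨S₀, AddMonoidHomClass.continuous_of_bound S₀ 1 hnorm⟩
  have hS : ∀ x, Tendsto (fun k => T k x) atTop (𝓝 (S x)) := hf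
  have hq : ∀ x, Tendsto (fun k => quadForm R x (T k)) atTop (𝓝 (quadForm R x S)) := fun x =>
    (hS x).inner tendsto_const_nhds
  refine ⟨S, ⟨fun x y => ?_, fun v => ⟨?_, ?_⟩⟩, hS⟩
  · refine tendsto_nhds_unique ((hS x).inner tendsto_const_nhds) ?_
    simp only [(hT _).1 x y]
    exact tendsto_const_nhds.inner (hS y)
  · exact ge_of_tendsto (hq v) (Eventually.of_forall fun k => ((hT k).2 v).1)
  · exact le_of_tendsto (hq v) (Eventually.of_forall fun k => ((hT k).2 v).2)

/-- Idempotency passes to the strong limit in the form `⟪T x, T y⟫ = ⟪T x, y⟫`, by joint continuity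
of the inner product. -/
theorem mem_symmProjections_of_tendsto {T : ℕ → H →L[R] H} {S : H →L[R] H}
    (hT : ∀ k, T k ∈ symmProjections R H) (hSsymm : IsRealSymmetric S)
    (hS : ∀ x, Tendsto (fun k => T k x) atTop (𝓝 (S x))) : S ∈ symmProjections R H := by
  refine ⟨hSsymm, ContinuousLinearMap.ext fun x => ext_inner_right ℝ fun y => ?_⟩
  rw [mul_apply_eq_comp, hSsymm]
  refine tendsto_nhds_unique ((hS x).inner (hS y)) ?_
  have h : ∀ k, inner ℝ (T k x) (T k y) = inner ℝ (T k x) y := fun k => by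
    rw [← (hT k).1, ← mul_apply_eq_comp, (hT k).2]
  simp only [h]
  exact (hS x).inner tendsto_const_nhds

/-- At the vector `Q v` the bound reads `‖P (Q v)‖ ^ 2 + ‖Q v‖ ^ 2 ≤ ‖Q v‖ ^ 2`. -/
theorem mul_eq_zero_of_mem_symmProjections {P Q : H →L[R] H} (hP : P ∈ symmProjections R H)
    (hQ : Q ∈ symmProjections R H) (h : ∀ v, quadForm R v (P + Q) ≤ ‖v‖ ^ 2) : P * Q = 0 := by
  ext v
  have h1 := h (Q v)
  have h2 : Q (Q v) = Q v := DFunLike.congr_fun hQ.2 v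
  rw [map_add, quadForm_of_mem_symmProjections hP, quadForm_of_mem_symmProjections hQ, h2] at h1
  have h3 : ‖P (Q v)‖ = 0 := by nlinarith [norm_nonneg (P (Q v))]
  simpa using h3

theorem add_mem_symmProjections {P Q : H →L[R] H} (hP : P ∈ symmProjections R H)
    (hQ : Q ∈ symmProjections R H) (h : ∀ v, quadForm R v (P + Q) ≤ ‖v‖ ^ 2) :
    P + Q ∈ symmProjections R H := by
  have h1 := mul_eq_zero_of_mem_symmProjections hP hQ h
  have h2 := mul_eq_zero_of_mem_symmProjections hQ hP fun v => by rw [add_comm]; exact h v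
  exact ⟨hP.1.add hQ.1, by rw [mul_add, add_mul, add_mul, hP.2, hQ.2, h1, h2, add_zero, zero_add]⟩

theorem Icc_zero_one_eq_symmEffects [PartialOrder (H →L[R] H)]
    (hle : ∀ A B : H →L[R] H, A ≤ B ↔ IsRealSymmetric (B - A) ∧ ∀ v, 0 ≤ quadForm R v (B - A)) :
    Set.Icc (0 : H →L[R] H) 1 = symmEffects R H := by
  ext T
  rw [Set.mem_Icc, hle, hle, sub_zero]
  constructor
  · rintro ⟨⟨h1, h2⟩, -, h3⟩
    exact ⟨h1, fun v => ⟨h2 v, by simpa [quadForm_one] using h3 v⟩⟩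
  · intro hT
    exact ⟨⟨hT.1, fun v => (hT.2 v).1⟩, isRealSymmetric_one.sub hT.1, fun v => by
      simpa [quadForm_one] using (hT.2 v).2⟩

variable [CompleteSpace H] [ContinuousConstSMul R H] [PartialOrder (H →L[R] H)]

theorem isMonotoneDetermined_symmEffects
    (hle : ∀ A B : H →L[R] H, A ≤ B ↔ IsRealSymmetric (B - A) ∧ ∀ v, 0 ≤ quadForm R v (B - A)) :
    IsMonotoneDetermined (symmEffects R H) (quadForm R) where
  one_mem := one_mem_symmEffects
  one_sub_mem {a} ha := ⟨isRealSymmetric_one.sub ha.1, fun v => by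
    rw [map_sub, quadForm_one]
    have := ha.2 v
    constructor <;> linarith⟩
  nonneg_of_mem {a} ha := (hle 0 a).mpr (by
    rw [sub_zero]
    exact ⟨ha.1, fun v => (ha.2 v).1⟩)
  map_nonneg {a} ha v := by simpa using ((hle 0 a).mp ha).2 v
  le_iff {a b} ha hb := by
    rw [hle]
    simp only [map_sub, sub_nonneg]
    exact ⟨fun h => h.2, fun h => ⟨hb.1.sub ha.1, h⟩⟩
  add_mem {a b} ha hb h := ⟨ha.1.add hb.1, fun v => ⟨by
    rw [map_add]
    exact add_nonneg (ha.2 v).1 (hb.2 v).1, (h v).trans_eq (quadForm_one v)⟩⟩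
  exists_tendsto T hT hmono := by
    obtain ⟨S, hS, hlim⟩ := exists_tendsto_of_monotone_quadForm hT hmono
    exact ⟨S, hS, fun v => (hlim v).inner tendsto_const_nhds⟩

theorem isMonotoneDetermined_symmProjections
    (hle : ∀ A B : H →L[R] H, A ≤ B ↔ IsRealSymmetric (B - A) ∧ ∀ v, 0 ≤ quadForm R v (B - A)) :
    IsMonotoneDetermined (symmProjections R H) (quadForm R) where
  one_mem := one_mem_symmProjections
  one_sub_mem {a} ha := ⟨isRealSymmetric_one.sub ha.1, by
    rw [sub_mul, mul_sub, mul_sub, ha.2]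
    simp⟩
  nonneg_of_mem ha :=
    (isMonotoneDetermined_symmEffects hle).nonneg_of_mem (symmProjections_subset_symmEffects ha)
  map_nonneg := (isMonotoneDetermined_symmEffects hle).map_nonneg
  le_iff ha hb := (isMonotoneDetermined_symmEffects hle).le_iff
    (symmProjections_subset_symmEffects ha) (symmProjections_subset_symmEffects hb)
  add_mem ha hb h := add_mem_symmProjections ha hb fun v => (h v).trans_eq (quadForm_one v)
  exists_tendsto T hT hmono := by
    obtain ⟨S, hS, hlim⟩ := exists_tendsto_of_monotone_quadForm
      (fun k => symmProjections_subset_symmEffects (hT k)) hmono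
    exact ⟨S, mem_symmProjections_of_tendsto hT hS.1 hlim,
      fun v => (hlim v).inner tendsto_const_nhds⟩

end RealSymmetric

/-! ### Real and complex Hilbert spaces -/

section RCLike

variable {𝕜 H : Type*} [RCLike 𝕜] [NormedAddCommGroup H] [InnerProductSpace 𝕜 H]

theorem isRealSymmetric_iff_isSymmetric (A : H →L[𝕜] H) :
    letI := InnerProductSpace.rclikeToReal 𝕜 H
    IsRealSymmetric A ↔ (A : H →ₗ[𝕜] H).IsSymmetric := by
  let _ := InnerProductSpace.rclikeToReal 𝕜 H
  have hre : ∀ x y : H, inner ℝ x y = RCLike.re (inner 𝕜 x y) := fun _ _ => rfl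
  refine ⟨fun h x y => ?_, fun h x y => ?_⟩
  -- Real symmetry only kills the real part of the defect `d`; replacing `x` by `d • x` turns that
  -- real part into `‖d‖ ^ 2`.
  · set d : 𝕜 := inner 𝕜 (A x) y - inner 𝕜 x (A y) with hd
    have h1 := h (d • x) y
    rw [map_smul, hre, hre, inner_smul_left, inner_smul_left, ← sub_eq_zero, ← map_sub,
      ← mul_sub, ← hd, RCLike.conj_mul] at h1
    norm_cast at h1
    exact sub_eq_zero.mp (norm_eq_zero.mp (pow_eq_zero_iff two_ne_zero |>.mp h1))
  · rw [hre, hre]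
    exact congrArg _ (h x y)

theorem loewner_le_iff (A B : H →L[𝕜] H) :
    letI := InnerProductSpace.rclikeToReal 𝕜 H
    A ≤ B ↔ IsRealSymmetric (B - A) ∧ ∀ v, 0 ≤ quadForm 𝕜 v (B - A) := by
  let _ := InnerProductSpace.rclikeToReal 𝕜 H
  rw [isRealSymmetric_iff_isSymmetric, ContinuousLinearMap.le_def,
    ContinuousLinearMap.isPositive_def]
  rfl

theorem projectors_eq_symmProjections [CompleteSpace H] :
    letI := InnerProductSpace.rclikeToReal 𝕜 H
    projectors 𝕜 H = symmProjections 𝕜 H := by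
  let _ := InnerProductSpace.rclikeToReal 𝕜 H
  ext P
  simp only [projectors, symmProjections, Set.mem_ofPred_eq]
  rw [isRealSymmetric_iff_isSymmetric, isStarProjection_iff,
    ContinuousLinearMap.isSelfAdjoint_iff_isSymmetric, and_comm]
  rfl

end RCLike

/-! ### Quaternionic Hilbert spaces -/

namespace QuaternionicInnerProductSpace

variable {H : Type*} [NormedAddCommGroup H] [QuaternionicInnerProductSpace H]

theorem inner_smul_right (x y : H) (q : ℍ) : inner ℍ x (q • y) = inner ℍ x y * star q := by
  rw [← conj_inner_symm, smul_left, star_mul, conj_inner_symm]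

theorem inner_self_eq_coe (x : H) : inner ℍ x x = ((‖x‖ ^ 2 : ℝ) : ℍ) := by
  have h := conj_inner_symm x x
  rw [Quaternion.star_eq_self] at h
  rw [norm_sq_eq_re_inner]
  exact h

/-- Here `⟪q x, q x⟫ = q ⟪x, x⟫ q*`, and the middle factor is real, hence central. -/
theorem norm_smul_eq (q : ℍ) (x : H) : ‖q • x‖ = ‖q‖ * ‖x‖ := by
  have h : ‖q • x‖ ^ 2 = (‖q‖ * ‖x‖) ^ 2 := by
    rw [norm_sq_eq_re_inner, smul_left, inner_smul_right, inner_self_eq_coe, ← mul_assoc,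
      ← Quaternion.coe_commutes, mul_assoc, Quaternion.self_mul_star, ← Quaternion.coe_mul,
      Quaternion.re_coe, Quaternion.normSq_eq_norm_mul_self]
    ring
  exact (sq_eq_sq₀ (norm_nonneg _) (by positivity)).mp h

variable (H) in
/-- The real inner product space underlying a quaternionic inner product space. -/
noncomputable abbrev toReal : InnerProductSpace ℝ H where
  toModule := Module.compHom H (algebraMap ℝ ℍ)
  norm_smul_le r x := by
    refine (norm_smul_eq (r : ℍ) x).le.trans_eq ?_
    rw [Quaternion.norm_coe]
  inner x y := (inner ℍ x y).re
  norm_sq_eq_re_inner := norm_sq_eq_re_inner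
  conj_inner_symm x y := by
    rw [← conj_inner_symm x y, Quaternion.re_star]
    rfl
  add_left x y z := by rw [add_left, Quaternion.re_add]
  smul_left x y r := by
    change (inner ℍ ((r : ℍ) • x) y).re = _
    rw [smul_left, Quaternion.coe_mul_eq_smul, Quaternion.re_smul]
    rfl

theorem continuousConstSMul : ContinuousConstSMul ℍ H where
  continuous_const_smul q := AddMonoidHomClass.continuous_of_bound
    (DistribSMul.toAddMonoidHom H q) ‖q‖ fun x => (norm_smul_eq q x).le

theorem isRealSymmetric_iff_isHermitian (A : H →L[ℍ] H) :
    letI := toReal H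
    IsRealSymmetric A ↔ IsHermitian A := by
  let _ := toReal H
  have hre : ∀ x y : H, inner ℝ x y = (inner ℍ x y).re := fun _ _ => rfl
  refine ⟨fun h x y => ?_, fun h x y => ?_⟩
  · set d : ℍ := inner ℍ (A x) y - inner ℍ x (A y) with hd
    -- The form is linear, not conjugate-linear, in its first variable, so the conjugate `star d` is
    -- what produces `normSq d`.
    have h1 := h (star d • x) y
    rw [map_smul, hre, hre, smul_left, smul_left, ← sub_eq_zero, ← Quaternion.re_sub, ← mul_sub,
      ← hd, Quaternion.star_mul_self, Quaternion.re_coe, Quaternion.normSq_eq_zero] at h1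
    exact sub_eq_zero.mp h1
  · rw [hre, hre, h x y]

theorem le_iff_isRealSymmetric (A B : H →L[ℍ] H) :
    letI := toReal H
    A ≤ B ↔ IsRealSymmetric (B - A) ∧ ∀ v, 0 ≤ quadForm ℍ v (B - A) := by
  let _ := toReal H
  rw [isRealSymmetric_iff_isHermitian]
  rfl

theorem projectors_eq_symmProjections :
    letI := toReal H
    projectors H = symmProjections ℍ H := by
  let _ := toReal H
  ext P
  simp only [projectors, symmProjections, Set.mem_ofPred_eq]
  rw [isRealSymmetric_iff_isHermitian, and_comm]

end QuaternionicInnerProductSpace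

theorem mainTheorem7 (n : ℕ) (hn : 1 ≤ n) :
    (∀ (𝕜 : Type*) [RCLike 𝕜] (H : Type*) [NormedAddCommGroup H] [InnerProductSpace 𝕜 H]
        [CompleteSpace H],
      (∀ F : SpectralResolution (effects 𝕜 H) n,
        ∃! x : Observable (effects 𝕜 H) n, ∀ s, F.toFun s = x.toFun (lowerOrthant s)) ∧
      (∀ F : SpectralResolution (projectors 𝕜 H) n,
        ∃! x : Observable (projectors 𝕜 H) n, ∀ s, F.toFun s = x.toFun (lowerOrthant s))) ∧
    (∀ (H : Type*) [NormedAddCommGroup H] [QuaternionicInnerProductSpace H] [CompleteSpace H],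
      (∀ F : SpectralResolution (QuaternionicInnerProductSpace.effects H) n,
        ∃! x : Observable (QuaternionicInnerProductSpace.effects H) n,
          ∀ s, F.toFun s = x.toFun (lowerOrthant s)) ∧
      (∀ F : SpectralResolution (QuaternionicInnerProductSpace.projectors H) n,
        ∃! x : Observable (QuaternionicInnerProductSpace.projectors H) n,
          ∀ s, F.toFun s = x.toFun (lowerOrthant s))) := by
  refine ⟨fun 𝕜 _ H _ _ _ => ?_, fun H _ _ _ => ?_⟩
  -- Only the inner product becomes real; the operators remain `𝕜`-linear.
  · let _ := InnerProductSpace.rclikeToReal 𝕜 H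
    have hE : effects 𝕜 H = symmEffects 𝕜 H := Icc_zero_one_eq_symmEffects loewner_le_iff
    rw [hE, projectors_eq_symmProjections]
    exact ⟨(isMonotoneDetermined_symmEffects loewner_le_iff).existsUnique_observable,
      (isMonotoneDetermined_symmProjections loewner_le_iff).existsUnique_observable⟩
  · let _ := QuaternionicInnerProductSpace.toReal H
    have : ContinuousConstSMul ℍ H := QuaternionicInnerProductSpace.continuousConstSMul
    have hle := QuaternionicInnerProductSpace.le_iff_isRealSymmetric (H := H)
    have hE : QuaternionicInnerProductSpace.effects H = symmEffects ℍ H :=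
      Icc_zero_one_eq_symmEffects hle
    rw [hE, QuaternionicInnerProductSpace.projectors_eq_symmProjections]
    exact ⟨(isMonotoneDetermined_symmEffects hle).existsUnique_observable,
      (isMonotoneDetermined_symmProjections hle).existsUnique_observable⟩
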